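/- Let $N \ge 1$, let $\mathbb{R}^N_{++} = \{x \in \mathbb{R}^N : x_j > 0 \text{ for } j = 1,\dots,N\}$, and let $F : \mathbb{R}^N_{++} \to \mathbb{R}^N_{++}$ be continuously differentiable with Jacobian matrix $DF(x) = (\partial F_j(x)/\partial x_k)_{j,k}$. For $c > 0$ and $u, y \in \mathbb{R}^N$ write $c^u y = (c^{u_1} y_1, \dots, c^{u_N} y_N)$. Let $u \in \mathbb{R}^N$ have at least one non-zero entry and assume the following. (a) For every $x \in \mathbb{R}^N_{++}$ the matrix $|DF(x)|$ of absolute values of the entries of $DF(x)$ is irreducible, i.e. the directed graph on $\{1,\dots,N\}$ with an edge from $k$ to $j$ whenever $\partial F_j(x)/\partial x_k \neq 0$ is strongly connected (any vertex can be reached from any other vertex). (b) $F(c^u x) = c^u F(x)$ for all $x \in \mathbb{R}^N_{++}$ and all $c > 0$. (c) $\{1,\dots,N\}$ is the union of two disjoint (possibly empty) sets $\zeta_+$ and $\zeta_-$ such that $u_j \ge 0$ for all $j \in \zeta_+$, $u_j \le 0$ for all $j \in \zeta_-$, and for all $x \in \mathbb{R}^N_{++}$ and all $j, k$ one has $\partial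 F_j(x)/\partial x_k \ge 0$ if $j$ and $k$ lie in the same one of the sets $\zeta_+, \zeta_-$, and $\partial F_j(x)/\partial x_k \le 0$ if they do not. (d) There exists $x^* \in \mathbb{R}^N_{++}$ with $x^* = F(x^*)$. Then: (i) The solutions $x \in \mathbb{R}^N_{++}$ of $x = F(x)$ are precisely the vectors $c^u x^*$ with $c > 0$. (ii) If, in addition, for every $x \in \mathbb{R}^N_{++}$ there is an index $j$ with $\partial F_j(x)/\partial x_j \neq 0$, then every solution $p \in \mathbb{R}^N_{++}$ of $p = F(p)$ is Lyapunov stable, i.e. for every $\varepsilon > 0$ there is $\delta > 0$ such that all $x \in \mathbb{R}^N_{++}$ with $\|x - p\| < \delta$ satisfy $\|F^n(x) - F^n(p)\| < \varepsilon$ for all integers $n \ge 0$; and for every $x \in \mathbb{R}^N_{++}$ the iterates $F^n(x)$ converge, as $n \to \infty$, to some $p \in \mathbb{R}^N_{++}$ with $p = F(p)$. -/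

import Mathlib

open Set Filter Topology

noncomputable section

/-- The open positive orthant of `ℝ^N`. -/
def posOrthant (N : ℕ) : Set (Fin N → ℝ) := {x | ∀ j, 0 < x j}

/-- The Jacobian matrix `DF(x)`: the entry in row `j` and column `k` is `∂F_j(x)/∂x_k`. -/
def jacobian {N : ℕ} (F : (Fin N → ℝ) → (Fin N → ℝ)) (x : Fin N → ℝ) :
    Matrix (Fin N) (Fin N) ℝ :=
  Matrix.of fun j k => fderiv ℝ F x (Pi.single k 1) j

/-- The entrywise modulus `|A|` of a real matrix. -/
def matrixModulus {N : ℕ} (A : Matrix (Fin N) (Fin N) ℝ) : Matrix (Fin N) (Fin N) ℝ :=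
  Matrix.of fun j k => |A j k|

/-- Irreducibility of a non-negative matrix `B`: the directed graph with an edge from `k` to `j`
whenever `B j k ≠ 0` is strongly connected. Walks of length zero are allowed, so every
`1 × 1` matrix is irreducible in this sense. -/
def IrreducibleMatrix {N : ℕ} (B : Matrix (Fin N) (Fin N) ℝ) : Prop :=
  ∀ a b : Fin N, Relation.ReflTransGen (fun k j => B j k ≠ 0) a b

/-- The vector `c^u x = (c^{u_1} x_1, …, c^{u_N} x_N)`. -/
def powScale {N : ℕ} (c : ℝ) (u x : Fin N → ℝ) : Fin N → ℝ := fun j => c ^ u j * x j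

/-- `F` connects all variables. -/
def ConnectsAllVariables {N : ℕ} (F : (Fin N → ℝ) → (Fin N → ℝ)) : Prop :=
  ∀ x ∈ posOrthant N, IrreducibleMatrix (matrixModulus (jacobian F x))

/-- `F` exhibits self-interaction. -/
def ExhibitsSelfInteraction {N : ℕ} (F : (Fin N → ℝ) → (Fin N → ℝ)) : Prop :=
  ∀ x ∈ posOrthant N, ∃ j, jacobian F x j j ≠ 0

/-- `F` scales with exponent `u`. -/
def ScalesWithExponent {N : ℕ} (F : (Fin N → ℝ) → (Fin N → ℝ)) (u : Fin N → ℝ) : Prop :=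
  ∀ x ∈ posOrthant N, ∀ c : ℝ, 0 < c → F (powScale c u x) = powScale c u (F x)

/-- The monotonicity behavior of `F` is consistent with `u`. One of the two sets of the
partition may be empty. -/
def MonotonicityConsistent {N : ℕ} (F : (Fin N → ℝ) → (Fin N → ℝ)) (u : Fin N → ℝ) : Prop :=
  ∃ P M : Set (Fin N), P ∪ M = univ ∧ Disjoint P M ∧
    (∀ j ∈ P, 0 ≤ u j) ∧ (∀ j ∈ M, u j ≤ 0) ∧
    ∀ x ∈ posOrthant N, ∀ j k : Fin N,
      (((j ∈ P ∧ k ∈ P) ∨ (j ∈ M ∧ k ∈ M)) → 0 ≤ jacobian F x j k) ∧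
      (((j ∈ P ∧ k ∈ M) ∨ (j ∈ M ∧ k ∈ P)) → jacobian F x j k ≤ 0)

/-- `x` is a solution in the positive orthant of the fixed point equation `x = F(x)`. -/
def IsPosSolution {N : ℕ} (F : (Fin N → ℝ) → (Fin N → ℝ)) (x : Fin N → ℝ) : Prop :=
  x ∈ posOrthant N ∧ x = F x

/-- Lyapunov stability of `p` for the iteration of `F` on the positive orthant
(independent of the choice of the norm on `ℝ^N`). -/
def LyapunovStable {N : ℕ} (F : (Fin N → ℝ) → (Fin N → ℝ)) (p : Fin N → ℝ) : Prop :=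
  ∀ ε : ℝ, 0 < ε → ∃ δ : ℝ, 0 < δ ∧ ∀ x ∈ posOrthant N, ‖x - p‖ < δ →
    ∀ n : ℕ, ‖F^[n] x - F^[n] p‖ < ε

end

/-! Euler's identity and irreducibility force every `u j` to be non-zero, so `x_j = exp (u_j y_j)`
is a chart of the orthant. In it `F` becomes a map `G` that is monotone by (c) and commutes with
adding constants by (b), hence is nonexpansive for the sup norm; this gives stability.

`chartMap_lt_chartMap` adds strictness: if `z ≤ w` and `z k < w k`, then `G z j < G w j` for each
edge from `k` to `j` of the Jacobian graph at `w`. For uniqueness, translate one fixed point until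
it touches the other from above: a strict coordinate would propagate to the touching one.

For convergence, let `z` be an accumulation point of an orbit and `M x = max_j (x_j - w_j)` for a
fixed point `w`. As `M` decreases along orbits, it is constant on that of `z`. If `z` differed from
the fixed point `w + M z`, a self-loop would make all coordinates strict at one common time, and `M`
would drop. So `z` is fixed, and nonexpansiveness makes the whole orbit converge. -/

/-- For a fixed sub-relation `R` of strict dependence, a point lying below a fixed point `w` and
different from it is eventually strictly below `w` in every coordinate. -/
theorem exists_iterate_lt_fixedPoint {ι : Type*} [Finite ι] {G : (ι → ℝ) → (ι → ℝ)}
    (hmono : Monotone G) {w : ι → ℝ} (hw : G w = w) {R : ι → ι → Prop}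
    (hR : ∀ z k j, R k j → z ≤ w → z k < w k → G z j < G w j)
    (hconn : ∀ a b, Relation.ReflTransGen R a b) {i : ι} (hi : R i i)
    {z : ι → ℝ} (hz : z ≤ w) (hne : z ≠ w) : ∃ n : ℕ, ∀ j, G^[n] z j < w j := by
  have hle : ∀ n, G^[n] z ≤ w := fun n => by
    simpa [Function.iterate_fixed hw n] using hmono.iterate n hz
  have hstep : ∀ n k j, R k j → G^[n] z k < w k → G^[n + 1] z j < w j := by
    intro n k j hkj hk
    rw [Function.iterate_succ_apply']
    simpa [hw] using hR _ k j hkj (hle n) hk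
  obtain ⟨k, hk⟩ : ∃ k, z k < w k := by
    by_contra! h
    exact hne (le_antisymm hz h)
  obtain ⟨m, hm⟩ : ∃ m, G^[m] z i < w i := by
    have h := hconn k i
    clear hi
    induction h with
    | refl => exact ⟨0, hk⟩
    | tail _ hbc ih =>
      obtain ⟨m, hm⟩ := ih
      exact ⟨m + 1, hstep m _ _ hbc hm⟩
  -- The loop at `i` keeps coordinate `i` strict from time `m` on, and each edge delays this by one
  -- step. Without a loop, different coordinates might be strict only at different times.
  have hev : ∀ j, ∀ᶠ n in atTop, G^[n] z j < w j := by
    intro j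
    have h := hconn i j
    induction h with
    | refl =>
      filter_upwards [eventually_ge_atTop m] with n hn
      induction n, hn using Nat.le_induction with
      | base => exact hm
      | succ n _ ih => exact hstep n i i hi ih
    | tail _ hbc ih =>
      rw [← map_add_atTop_eq_nat 1, eventually_map]
      exact ih.mono fun n hn => hstep n _ _ hbc hn
  exact (eventually_all.2 hev).exists

/-! ### Monotone maps commuting with translations by constants -/

section Topical

variable {ι : Type*} [Fintype ι] {G : (ι → ℝ) → (ι → ℝ)}

/-- A monotone map commuting with the addition of constants is nonexpansive for the sup norm. -/
theorem lipschitzWith_one_of_monotone_of_add_const (hmono : Monotone G)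
    (htrans : ∀ y t, G (fun j => y j + t) = fun j => G y j + t) : LipschitzWith 1 G := by
  have key : ∀ y z j, G y j ≤ G z j + dist y z := by
    intro y z j
    have h : y ≤ fun j => z j + dist y z := fun k => by
      have h1 := dist_le_pi_dist y z k
      rw [Real.dist_eq] at h1
      linarith [le_abs_self (y k - z k)]
    have h2 := hmono h j
    rwa [htrans] at h2
  refine LipschitzWith.of_dist_le_mul fun y z => ?_
  rw [NNReal.coe_one, one_mul, dist_pi_le_iff dist_nonneg]
  intro j
  rw [Real.dist_eq, abs_le]
  have h1 := key y z j
  have h2 := key z y j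
  rw [dist_comm] at h2
  constructor <;> linarith

/-- The smallest translate of `w` by a constant that dominates `z` touches `z`. -/
theorem exists_le_add_const_touching [Nonempty ι] (z w : ι → ℝ) :
    ∃ t : ℝ, (z ≤ fun j => w j + t) ∧ ∃ j, z j = w j + t := by
  obtain ⟨i, hi⟩ := Finite.exists_max fun j => z j - w j
  exact ⟨z i - w i, fun j => by have := hi j; dsimp only at this ⊢; linarith, i, by ring⟩

/-- Uniqueness up to constants of fixed points. -/
theorem fixedPoint_eq_add_const [Nonempty ι]
    (htrans : ∀ y t, G (fun j => y j + t) = fun j => G y j + t)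
    {R : (ι → ℝ) → ι → ι → Prop}
    (hR : ∀ w z k j, R w k j → z ≤ w → z k < w k → G z j < G w j)
    (hconn : ∀ w a b, Relation.ReflTransGen (R w) a b)
    {y w : ι → ℝ} (hy : G y = y) (hw : G w = w) : ∃ t : ℝ, y = fun j => w j + t := by
  obtain ⟨t, hle, i, hi⟩ := exists_le_add_const_touching y w
  refine ⟨t, ?_⟩
  have hw' : G (fun j => w j + t) = fun j => w j + t := by rw [htrans, hw]
  by_contra hne
  obtain ⟨k, hk⟩ : ∃ k, y k < w k + t := by
    by_contra! h
    exact hne (le_antisymm hle h)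
  have hall : y i < w i + t := by
    have h := hconn (fun j => w j + t) k i
    clear hi
    induction h with
    | refl => exact hk
    | tail _ hbc ih =>
      have h := hR _ y _ _ hbc hle ih
      rwa [hw', hy] at h
  exact hall.ne hi

/-- Convergence of all orbits to fixed points. -/
theorem tendsto_iterate_fixedPoint [Nonempty ι] (hmono : Monotone G)
    (htrans : ∀ y t, G (fun j => y j + t) = fun j => G y j + t)
    {R : (ι → ℝ) → ι → ι → Prop}
    (hR : ∀ w z k j, R w k j → z ≤ w → z k < w k → G z j < G w j)
    (hconn : ∀ w a b, Relation.ReflTransGen (R w) a b) (hself : ∀ w, ∃ i, R w i i)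
    {w : ι → ℝ} (hw : G w = w) (y : ι → ℝ) :
    ∃ q, G q = q ∧ Tendsto (fun n => G^[n] y) atTop (𝓝 q) := by
  have hlip := lipschitzWith_one_of_monotone_of_add_const hmono htrans
  have hdist : ∀ x z, dist (G x) (G z) ≤ dist x z := fun x z => by
    simpa using hlip.dist_le_mul x z
  have hanti : ∀ q, G q = q → Antitone fun n => dist (G^[n] y) q := fun q hq =>
    antitone_nat_of_succ_le fun n => by
      rw [Function.iterate_succ_apply']
      simpa [hq] using hdist (G^[n] y) q
  obtain ⟨z, -, φ, hφ, hz⟩ := (isCompact_closedBall w (dist y w)).tendsto_subseq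
    (x := fun n => G^[n] y) fun n => hanti w hw (Nat.zero_le n)
  -- `M x` is the least `t` with `x ≤ w + t`.
  let M : (ι → ℝ) → ℝ := fun x => Finset.univ.sup' Finset.univ_nonempty fun j => x j - w j
  have hMcont : Continuous M :=
    Continuous.finset_sup'_apply _ fun j _ => (continuous_apply j).sub continuous_const
  have hle : ∀ x, x ≤ fun j => w j + M x := fun x j => by
    have : x j - w j ≤ M x := Finset.le_sup' (fun j => x j - w j) (Finset.mem_univ j)
    dsimp only
    linarith
  have hfix : ∀ t : ℝ, G (fun j => w j + t) = fun j => w j + t := fun t => by rw [htrans, hw]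
  have hMG : ∀ x, M (G x) ≤ M x := fun x => by
    refine Finset.sup'_le _ _ fun j _ => ?_
    have h := hmono (hle x) j
    rw [hfix] at h
    dsimp only at h
    linarith
  have hManti : Antitone fun n => M (G^[n] y) := antitone_nat_of_succ_le fun n => by
    rw [Function.iterate_succ_apply']
    exact hMG _
  -- `M` has a limit along the whole orbit of `y`, so shifting the subsequence by `n` does not
  -- change it.
  have hMz : ∀ n, M (G^[n] z) = M z := by
    intro n
    have h0 : Tendsto (fun i => M (G^[φ i] y)) atTop (𝓝 (M z)) := (hMcont.tendsto z).comp hz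
    have hlim : Tendsto (fun n => M (G^[n] y)) atTop (𝓝 (M z)) :=
      (tendsto_iff_tendsto_subseq_of_antitone hManti hφ.tendsto_atTop).2 h0
    have h1 : Tendsto (fun i => M (G^[n] (G^[φ i] y))) atTop (𝓝 (M (G^[n] z))) :=
      ((hMcont.comp (hlip.continuous.iterate n)).tendsto z).comp hz
    simp_rw [← Function.iterate_add_apply] at h1
    exact tendsto_nhds_unique h1
      (hlim.comp (tendsto_atTop_mono (fun i => Nat.le_add_left _ _) hφ.tendsto_atTop))
  have hzfix : z = fun j => w j + M z := by
    by_contra hne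
    obtain ⟨i, hi⟩ := hself fun j => w j + M z
    obtain ⟨n, hn⟩ := exists_iterate_lt_fixedPoint hmono (hfix (M z)) (hR _) (hconn _)
      hi (hle z) hne
    have : M (G^[n] z) < M z := by
      refine (Finset.sup'_lt_iff _).2 fun j _ => ?_
      have := hn j
      linarith
    exact this.ne (hMz n)
  have hGz : G z = z := by rw [hzfix]; exact hfix _
  refine ⟨z, hGz, tendsto_iff_dist_tendsto_zero.2 ?_⟩
  exact (tendsto_iff_tendsto_subseq_of_antitone (hanti z hGz) hφ.tendsto_atTop).2
    (tendsto_iff_dist_tendsto_zero.1 hz)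

end Topical

/-! ### Logarithmic coordinates and the conjugated map -/

section Chart

variable {N : ℕ}

theorem isOpen_posOrthant : IsOpen (posOrthant N) := by
  have : posOrthant N = ⋂ j, {x | 0 < x j} := by ext; simp [posOrthant]
  rw [this]
  exact isOpen_iInter_of_finite fun j => isOpen_lt continuous_const (continuous_apply j)

/-- The parametrisation of the positive orthant by `y ↦ (exp (u_j y_j))_j`. -/
noncomputable def expChart (u y : Fin N → ℝ) : Fin N → ℝ := fun j => Real.exp (u j * y j)

/-- The inverse of `expChart u`, for `u` without zero entries. -/
noncomputable def logChart (u x : Fin N → ℝ) : Fin N → ℝ := fun j => Real.log (x j) / u j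

theorem expChart_mem_posOrthant (u y : Fin N → ℝ) : expChart u y ∈ posOrthant N :=
  fun _ => Real.exp_pos _

theorem expChart_logChart {u : Fin N → ℝ} (hu : ∀ j, u j ≠ 0) {x : Fin N → ℝ}
    (hx : x ∈ posOrthant N) : expChart u (logChart u x) = x := by
  ext j
  rw [expChart, logChart, mul_div_cancel₀ _ (hu j), Real.exp_log (hx j)]

theorem logChart_expChart {u : Fin N → ℝ} (hu : ∀ j, u j ≠ 0) (y : Fin N → ℝ) :
    logChart u (expChart u y) = y := by
  ext j
  rw [logChart, expChart, Real.log_exp, mul_div_cancel_left₀ _ (hu j)]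

theorem continuous_expChart (u : Fin N → ℝ) : Continuous (expChart u) := by
  unfold expChart
  fun_prop

theorem continuousAt_logChart (u : Fin N → ℝ) {x : Fin N → ℝ} (hx : x ∈ posOrthant N) :
    ContinuousAt (logChart u) x :=
  continuousAt_pi.2 fun j =>
    ContinuousAt.div_const (ContinuousAt.log (f := fun y : Fin N → ℝ => y j)
      (continuous_apply j).continuousAt (hx j).ne') (u j)

/-- The weight `u j` in the exponent of the chart is there to turn scaling into translation. -/
theorem expChart_add_const (u y : Fin N → ℝ) (t : ℝ) :
    expChart u (fun j => y j + t) = powScale (Real.exp t) u (expChart u y) := by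
  ext j
  simp only [powScale, expChart]
  rw [← Real.exp_mul, ← Real.exp_add]
  ring_nf

variable {F : (Fin N → ℝ) → (Fin N → ℝ)}

/-- The chain rule along a curve in the positive orthant, in terms of the Jacobian matrix. -/
theorem hasDerivAt_comp_curve (hF : ContDiffOn ℝ 1 F (posOrthant N)) {γ : ℝ → Fin N → ℝ}
    {γ' : Fin N → ℝ} {s : ℝ} (hγ : HasDerivAt γ γ' s) (hs : γ s ∈ posOrthant N) (j : Fin N) :
    HasDerivAt (fun t => F (γ t) j) (∑ k, jacobian F (γ s) j k * γ' k) s := by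
  have hd : DifferentiableAt ℝ F (γ s) :=
    (hF.differentiableOn one_ne_zero).differentiableAt (isOpen_posOrthant.mem_nhds hs)
  have h := hasDerivAt_pi.1 (hd.hasFDerivAt.comp_hasDerivAt s hγ) j
  refine h.congr_deriv ?_
  conv_lhs => rw [pi_eq_sum_univ' γ']
  simp [map_sum, jacobian, mul_comm, Pi.single]

/-- Differentiating the scaling law at `c = 1` gives Euler's identity. If `u i = 0`, its terms in
row `i` share one sign and sum to zero, so all vanish; hence being non-zero propagates along edges.
-/
theorem ne_zero_of_scaling (hF : ContDiffOn ℝ 1 F (posOrthant N)) {u : Fin N → ℝ} (hu : ∃ j, u j ≠ 0)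
    (hconn : ConnectsAllVariables F) (hscal : ScalesWithExponent F u)
    (hmono : MonotonicityConsistent F u) {x : Fin N → ℝ} (hx : x ∈ posOrthant N) (j : Fin N) :
    u j ≠ 0 := by
  obtain ⟨P, M, hPM, -, hP, hM, hsign⟩ := hmono
  have euler : ∀ j, ∑ k, jacobian F x j k * (u k * x k) = u j * F x j := by
    intro j
    have hγ : HasDerivAt (fun t : ℝ => fun k => Real.exp (u k * t) * x k)
        (fun k => u k * x k) 0 := by
      refine hasDerivAt_pi.2 fun k => ?_
      have := (((hasDerivAt_id (0 : ℝ)).const_mul (u k)).exp).mul_const (x k)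
      simpa using this
    have h1 := hasDerivAt_comp_curve hF hγ (by simpa using hx) j
    have h2 : HasDerivAt (fun t : ℝ => Real.exp (u j * t) * F x j) (u j * F x j) 0 := by
      have := (((hasDerivAt_id (0 : ℝ)).const_mul (u j)).exp).mul_const (F x j)
      simpa using this
    have heq : (fun t : ℝ => F (fun k => Real.exp (u k * t) * x k) j) =
        fun t : ℝ => Real.exp (u j * t) * F x j := by
      funext t
      have h := congrFun (hscal x hx (Real.exp t) (Real.exp_pos t)) j
      have h3 : powScale (Real.exp t) u x = fun k => Real.exp (u k * t) * x k := by
        funext k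
        rw [powScale, ← Real.exp_mul, mul_comm t]
      rw [h3] at h
      rw [h, powScale, ← Real.exp_mul, mul_comm t]
    rw [heq] at h1
    simpa using h1.unique h2
  have hstep : ∀ k i, u k ≠ 0 → jacobian F x i k ≠ 0 → u i ≠ 0 := by
    intro k i hk hik hi
    have hsum := euler i
    rw [hi, zero_mul] at hsum
    have hmem : ∀ a, a ∈ P ∨ a ∈ M := fun a => by
      have : a ∈ P ∪ M := hPM ▸ mem_univ a
      exact this
    have hzero : ∀ l, jacobian F x i l * (u l * x l) = 0 := by
      rcases hmem i with hiP | hiM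
      · have hnn : ∀ l, 0 ≤ jacobian F x i l * (u l * x l) := by
          intro l
          rcases hmem l with hl | hl
          · exact mul_nonneg ((hsign x hx i l).1 (.inl ⟨hiP, hl⟩))
              (mul_nonneg (hP l hl) (hx l).le)
          · exact mul_nonneg_of_nonpos_of_nonpos ((hsign x hx i l).2 (.inl ⟨hiP, hl⟩))
              (mul_nonpos_of_nonpos_of_nonneg (hM l hl) (hx l).le)
        exact fun l => (Finset.sum_eq_zero_iff_of_nonneg fun l _ => hnn l).1 hsum l
          (Finset.mem_univ l)
      · have hnp : ∀ l, jacobian F x i l * (u l * x l) ≤ 0 := by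
          intro l
          rcases hmem l with hl | hl
          · exact mul_nonpos_of_nonpos_of_nonneg ((hsign x hx i l).2 (.inr ⟨hiM, hl⟩))
              (mul_nonneg (hP l hl) (hx l).le)
          · exact mul_nonpos_of_nonneg_of_nonpos ((hsign x hx i l).1 (.inr ⟨hiM, hl⟩))
              (mul_nonpos_of_nonpos_of_nonneg (hM l hl) (hx l).le)
        exact fun l => (Finset.sum_eq_zero_iff_of_nonpos fun l _ => hnp l).1 hsum l
          (Finset.mem_univ l)
    exact mul_ne_zero hik (mul_ne_zero hk (hx k).ne') (hzero k)
  obtain ⟨i, hi⟩ := hu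
  have h := hconn x hx i j
  induction h with
  | refl => exact hi
  | tail _ hbc ih => exact hstep _ _ ih (by simpa [matrixModulus] using hbc)

/-- Consistent monotonicity says that the Jacobian of `F` in the chart `expChart u` is
nonnegative. -/
theorem jacobian_mul_div_nonneg {u : Fin N → ℝ} (hmono : MonotonicityConsistent F u)
    {x : Fin N → ℝ} (hx : x ∈ posOrthant N) (j k : Fin N) :
    0 ≤ jacobian F x j k * (u k / u j) := by
  obtain ⟨P, M, hPM, -, hP, hM, hsign⟩ := hmono
  have hmem : ∀ a, a ∈ P ∨ a ∈ M := fun a => by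
    have : a ∈ P ∪ M := hPM ▸ mem_univ a
    exact this
  obtain ⟨h1, h2⟩ := hsign x hx j k
  rcases hmem j with hj | hj <;> rcases hmem k with hk | hk
  · exact mul_nonneg (h1 (.inl ⟨hj, hk⟩)) (div_nonneg (hP k hk) (hP j hj))
  · exact mul_nonneg_of_nonpos_of_nonpos (h2 (.inl ⟨hj, hk⟩))
      (div_nonpos_of_nonpos_of_nonneg (hM k hk) (hP j hj))
  · exact mul_nonneg_of_nonpos_of_nonpos (h2 (.inr ⟨hj, hk⟩))
      (div_nonpos_of_nonneg_of_nonpos (hP k hk) (hM j hj))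
  · exact mul_nonneg (h1 (.inr ⟨hj, hk⟩)) (div_nonneg_of_nonpos (hM k hk) (hM j hj))

/-- The map `F` in the chart `expChart u`. -/
noncomputable def chartMap (F : (Fin N → ℝ) → (Fin N → ℝ)) (u y : Fin N → ℝ) : Fin N → ℝ :=
  logChart u (F (expChart u y))

/-- The terms are grouped so that `jacobian_mul_div_nonneg` controls the first factor. If `u j = 0`,
both sides are zero by the convention on division. -/
theorem hasDerivAt_chartMap_line (hmaps : MapsTo F (posOrthant N) (posOrthant N))
    (hF : ContDiffOn ℝ 1 F (posOrthant N)) (u y d : Fin N → ℝ) (j : Fin N) (s : ℝ) :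
    HasDerivAt (fun t : ℝ => chartMap F u (fun k => y k + t * d k) j)
      (∑ k, jacobian F (expChart u fun k => y k + s * d k) j k * (u k / u j) *
        (d k * (expChart u (fun k => y k + s * d k) k / F (expChart u fun k => y k + s * d k) j)))
      s := by
  set x := expChart u fun k => y k + s * d k with hx
  have hxpos : x ∈ posOrthant N := expChart_mem_posOrthant _ _
  have hγ : HasDerivAt (fun t : ℝ => expChart u fun k => y k + t * d k)
      (fun k => x k * (u k * d k)) s := by
    refine hasDerivAt_pi.2 fun k => ?_
    have := ((((hasDerivAt_id s).mul_const (d k)).const_add (y k)).const_mul (u k)).exp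
    exact this.congr_deriv (by simp [hx, expChart])
  have h := ((hasDerivAt_comp_curve hF hγ hxpos j).log (hmaps hxpos j).ne').div_const (u j)
  refine h.congr_deriv ?_
  rw [Finset.sum_div, Finset.sum_div]
  refine Finset.sum_congr rfl fun k _ => ?_
  ring

theorem monotone_chartMap_line (hmaps : MapsTo F (posOrthant N) (posOrthant N))
    (hF : ContDiffOn ℝ 1 F (posOrthant N)) {u : Fin N → ℝ} (hmono : MonotonicityConsistent F u)
    (y : Fin N → ℝ) {d : Fin N → ℝ} (hd : ∀ k, 0 ≤ d k) (j : Fin N) :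
    Monotone fun t : ℝ => chartMap F u (fun k => y k + t * d k) j := by
  refine monotone_of_hasDerivAt_nonneg
    (fun s => hasDerivAt_chartMap_line hmaps hF u y d j s) fun s => ?_
  have hx := expChart_mem_posOrthant u fun k => y k + s * d k
  exact Finset.sum_nonneg fun k _ => mul_nonneg (jacobian_mul_div_nonneg hmono hx j k)
    (mul_nonneg (hd k) (div_nonneg (hx k).le (hmaps hx j).le))

theorem monotone_chartMap (hmaps : MapsTo F (posOrthant N) (posOrthant N))
    (hF : ContDiffOn ℝ 1 F (posOrthant N)) {u : Fin N → ℝ}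
    (hmono : MonotonicityConsistent F u) : Monotone (chartMap F u) := by
  intro z w hzw j
  have h := monotone_chartMap_line hmaps hF hmono z (d := fun k => w k - z k)
    (fun k => sub_nonneg.2 (hzw k)) j zero_le_one
  simpa using h

/-- If the values agreed, the coordinate would be constant along the segment from `z` to `w`, so its
one-sided derivative at `w` would vanish, although the `k`-th of its nonnegative terms is positive.
Only the Jacobian at `w` enters, so the graph stays the same while `z` is iterated below a fixed
point `w`. -/
theorem chartMap_lt_chartMap (hmaps : MapsTo F (posOrthant N) (posOrthant N))
    (hF : ContDiffOn ℝ 1 F (posOrthant N)) {u : Fin N → ℝ} (hu : ∀ j, u j ≠ 0)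
    (hmono : MonotonicityConsistent F u) {w z : Fin N → ℝ} {k j : Fin N}
    (hkj : jacobian F (expChart u w) j k ≠ 0) (hzw : z ≤ w) (hk : z k < w k) :
    chartMap F u z j < chartMap F u w j := by
  refine (monotone_chartMap hmaps hF hmono hzw j).lt_of_ne fun heq => ?_
  have hline := monotone_chartMap_line hmaps hF hmono z (d := fun k => w k - z k)
    (fun k => sub_nonneg.2 (hzw k)) j
  have hderiv := hasDerivAt_chartMap_line hmaps hF u z (fun k => w k - z k) j 1
  have hx := expChart_mem_posOrthant u w
  simp only [one_mul, add_sub_cancel] at hderiv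
  have hconst : ∀ t ∈ Icc (0 : ℝ) 1,
      chartMap F u (fun k => z k + t * (w k - z k)) j = chartMap F u w j := by
    intro t ht
    have h0 := hline ht.1
    have h1 := hline ht.2
    simp only [zero_mul, add_zero, one_mul, add_sub_cancel] at h0 h1
    exact le_antisymm h1 (heq ▸ h0)
  have hzero := (uniqueDiffOn_Icc (zero_lt_one' ℝ) 1 (by simp)).eq_deriv _
    hderiv.hasDerivWithinAt
    ((hasDerivWithinAt_const (1 : ℝ) (Icc (0 : ℝ) 1) (chartMap F u w j)).congr hconst
      (hconst 1 (by simp)))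
  have hnn : ∀ l, 0 ≤ jacobian F (expChart u w) j l * (u l / u j) *
      ((w l - z l) * (expChart u w l / F (expChart u w) j)) := fun l =>
    mul_nonneg (jacobian_mul_div_nonneg hmono hx j l)
      (mul_nonneg (sub_nonneg.2 (hzw l)) (div_nonneg (hx l).le (hmaps hx j).le))
  have := (Finset.sum_eq_zero_iff_of_nonneg fun l _ => hnn l).1 hzero k (Finset.mem_univ k)
  exact mul_ne_zero (mul_ne_zero hkj (div_ne_zero (hu k) (hu j)))
    (mul_ne_zero (sub_pos.2 hk).ne' (div_pos (hx k) (hmaps hx j)).ne') this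

theorem expChart_chartMap (hmaps : MapsTo F (posOrthant N) (posOrthant N)) {u : Fin N → ℝ}
    (hu : ∀ j, u j ≠ 0) (y : Fin N → ℝ) :
    expChart u (chartMap F u y) = F (expChart u y) :=
  expChart_logChart hu (hmaps (expChart_mem_posOrthant u y))

theorem expChart_iterate_chartMap (hmaps : MapsTo F (posOrthant N) (posOrthant N))
    {u : Fin N → ℝ} (hu : ∀ j, u j ≠ 0) (n : ℕ) (y : Fin N → ℝ) :
    expChart u ((chartMap F u)^[n] y) = F^[n] (expChart u y) :=
  Function.Semiconj.iterate_right (fun y => expChart_chartMap hmaps hu y) n y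

theorem chartMap_add_const {u : Fin N → ℝ} (hmaps : MapsTo F (posOrthant N) (posOrthant N))
    (hu : ∀ j, u j ≠ 0) (hscal : ScalesWithExponent F u) (y : Fin N → ℝ) (t : ℝ) :
    chartMap F u (fun j => y j + t) = fun j => chartMap F u y j + t := by
  rw [chartMap, expChart_add_const,
    hscal _ (expChart_mem_posOrthant u y) _ (Real.exp_pos t), ← expChart_chartMap hmaps hu,
    ← expChart_add_const, logChart_expChart hu]

theorem chartMap_logChart_of_isPosSolution {u : Fin N → ℝ} (hu : ∀ j, u j ≠ 0) {p : Fin N → ℝ}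
    (hp : IsPosSolution F p) : chartMap F u (logChart u p) = logChart u p := by
  rw [chartMap, expChart_logChart hu hp.1, ← hp.2]

theorem isPosSolution_expChart (hmaps : MapsTo F (posOrthant N) (posOrthant N))
    {u : Fin N → ℝ} (hu : ∀ j, u j ≠ 0) {q : Fin N → ℝ} (hq : chartMap F u q = q) :
    IsPosSolution F (expChart u q) :=
  ⟨expChart_mem_posOrthant u q, by rw [← expChart_chartMap hmaps hu, hq]⟩

end Chart

/-! ### Transfer back to the orthant -/

theorem mainTheorem1 {N : ℕ} (F : (Fin N → ℝ) → (Fin N → ℝ))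
    (hF_maps : MapsTo F (posOrthant N) (posOrthant N))
    (hF_C1 : ContDiffOn ℝ 1 F (posOrthant N))
    (u : Fin N → ℝ) (hu : ∃ j, u j ≠ 0)
    (h_conn : ConnectsAllVariables F)
    (h_scal : ScalesWithExponent F u)
    (h_mono : MonotonicityConsistent F u)
    (xs : Fin N → ℝ) (hxs : IsPosSolution F xs) :
    (∀ x : Fin N → ℝ, IsPosSolution F x ↔ ∃ c : ℝ, 0 < c ∧ x = powScale c u xs) ∧
    (ExhibitsSelfInteraction F →
      (∀ p : Fin N → ℝ, IsPosSolution F p → LyapunovStable F p) ∧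
      (∀ x ∈ posOrthant N, ∃ p : Fin N → ℝ, IsPosSolution F p ∧
        Tendsto (fun n : ℕ => F^[n] x) atTop (𝓝 p))) := by
  have hu0 : ∀ j, u j ≠ 0 := ne_zero_of_scaling hF_C1 hu h_conn h_scal h_mono hxs.1
  have : Nonempty (Fin N) := hu.nonempty
  have hmono := monotone_chartMap hF_maps hF_C1 h_mono
  have htrans := chartMap_add_const hF_maps hu0 h_scal
  have hR : ∀ (w z : Fin N → ℝ) (k j : Fin N), jacobian F (expChart u w) j k ≠ 0 → z ≤ w →
      z k < w k → chartMap F u z j < chartMap F u w j := fun w z k j =>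
    chartMap_lt_chartMap hF_maps hF_C1 hu0 h_mono
  have hconn : ∀ (w : Fin N → ℝ) (a b : Fin N),
      Relation.ReflTransGen (fun k j => jacobian F (expChart u w) j k ≠ 0) a b := by
    intro w a b
    simpa [matrixModulus] using h_conn _ (expChart_mem_posOrthant u w) a b
  have hxs_fix := chartMap_logChart_of_isPosSolution hu0 hxs
  refine ⟨fun x => ⟨fun hx => ?_, ?_⟩, fun hself => ⟨fun p hp ε hε => ?_, fun x hx => ?_⟩⟩
  · obtain ⟨t, ht⟩ := fixedPoint_eq_add_const htrans hR hconn
      (chartMap_logChart_of_isPosSolution hu0 hx) hxs_fix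
    refine ⟨Real.exp t, Real.exp_pos t, ?_⟩
    rw [← expChart_logChart hu0 hx.1, ht, expChart_add_const, expChart_logChart hu0 hxs.1]
  · rintro ⟨c, hc, rfl⟩
    refine ⟨fun j => mul_pos (Real.rpow_pos_of_pos hc _) (hxs.1 j), ?_⟩
    rw [h_scal xs hxs.1 c hc, ← hxs.2]
  · have hq := chartMap_logChart_of_isPosSolution hu0 hp
    have hlip := lipschitzWith_one_of_monotone_of_add_const hmono htrans
    obtain ⟨η, hη, hηε⟩ :=
      Metric.continuous_iff.1 (continuous_expChart u) (logChart u p) ε hε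
    obtain ⟨δ, hδ, hδη⟩ := Metric.continuousAt_iff.1 (continuousAt_logChart u hp.1) η hη
    refine ⟨δ, hδ, fun x hx hxp n => ?_⟩
    have h1 : dist ((chartMap F u)^[n] (logChart u x)) (logChart u p) < η := by
      have h := (hlip.iterate n).dist_le_mul (logChart u x) (logChart u p)
      rw [Function.iterate_fixed hq n, one_pow, NNReal.coe_one, one_mul] at h
      exact h.trans_lt (hδη (by rwa [dist_eq_norm]))
    have h2 := hηε _ h1
    rw [← Function.iterate_fixed hq n, expChart_iterate_chartMap hF_maps hu0,
      expChart_iterate_chartMap hF_maps hu0, expChart_logChart hu0 hx,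
      expChart_logChart hu0 hp.1, dist_eq_norm] at h2
    exact h2
  · obtain ⟨q, hq, hlim⟩ := tendsto_iterate_fixedPoint hmono htrans hR hconn
      (fun w => hself _ (expChart_mem_posOrthant u w)) hxs_fix (logChart u x)
    refine ⟨expChart u q, isPosSolution_expChart hF_maps hu0 hq, ?_⟩
    have h := ((continuous_expChart u).tendsto q).comp hlim
    refine h.congr fun n => ?_
    rw [Function.comp_apply, expChart_iterate_chartMap hF_maps hu0, expChart_logChart hu0 hx]
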